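/- Conventions. A simple polytope $P\subset\mathbb R^n$ is given by an irredundant system $\langle a_i,x\rangle+b_i\ge 0$, $i=1,\dots,m$, whose solution set is bounded and $n$-dimensional and such that exactly $n$ of its facets $F_i=\{x\in P:\langle a_i,x\rangle+b_i=0\}$ meet at each vertex. It is flag if any set of pairwise intersecting facets has a common point. Its moment-angle manifold is $\mathcal Z_P=\{(x,z)\in P\times\mathbb C^m:\ |z_i|^2=\langle a_i,x\rangle+b_i,\ i=1,\dots,m\}$. A face cut $\mathrm{fc}(P)\subset\mathbb R^{n+1}$ of $P$ is a polytope obtained from $P\times[0,1]$ by cutting off the codimension-two face $F_i\times\{1\}$ for some facet $F_i$ of $P$: one adds to the inequalities of $P\times[0,1]$ an affine inequality $h\ge0$, where $h<0$ at the vertices of $P\times[0,1]$ lying in $F_i\times\{1\}$ and $h>0$ at all its other vertices. Let $R$ be a commutative ring with unit and $k\ge2$. For $\alpha_i\in H^{n_i}(X;R)$, $1\le i\le k$, a defining system is a strictly upper triangular $(k+1)\times(k+1)$ matrix $C=(c_{ij})$ of homogeneous singular cochains of $X$, with $\deg c_{ij}=n_i+\dots+n_{j-1}-(j-i)+1$ for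 $i<j$, such that $c_{i,i+1}$ is a cocycle representing $\alpha_i$ and $dC-\bar C\cdot C=a(C)E_{1,k+1}$ for some cochain $a(C)$, where $\bar c=(-1)^{\deg c}c$. The $k$-fold Massey product $\langle\alpha_1,\dots,\alpha_k\rangle$ is the set of all classes $[a(C)]$; it is defined if this set is nonempty, and nontrivial if it is defined and does not contain $0$. **Corollary.** Let $F=F^r$ be an $r$-dimensional flag simple polytope, $r\ge1$, and suppose that there is a nontrivial $k$-fold Massey product of classes of degrees $n_1,\dots,n_k$ in $H^*(\mathcal Z_F;R)$. Then there is a sequence of polytopes $P^n$, $n\ge r$, with $P^r=F$ and such that $P^{n+1}$ is a face cut of $P^n$ for each $n\ge r$, that is, $P^n=\mathrm{fc}^{\,n-r}(F)$. Moreover, for every such sequence and every $n\ge r$, $P^n$ is an $n$-dimensional flag simple polytope and there is a nontrivial $k$-fold Massey product of classes of degrees $n_1,\dots,n_k$ in $H^*(\mathcal Z_{P^n};R)$. -/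

import Mathlib

open CategoryTheory Opposite
open scoped Simplicial

noncomputable section

/-! ## Simple polytopes given by systems of linear inequalities -/

/-- A finite system of affine inequalities `⟨a i, x⟩ + b i ≥ 0` in `ℝⁿ`. -/
structure HPolytope (n : ℕ) where
  /-- the set of indices of the inequalities -/
  ι : Type
  fin : Fintype ι
  a : ι → Fin n → ℝ
  b : ι → ℝ

attribute [instance] HPolytope.fin

namespace HPolytope

variable {n : ℕ}

/-- The value of the `i`-th affine function `⟨a i, x⟩ + b i`. -/
def ell (P : HPolytope n) (i : P.ι) (x : Fin n → ℝ) : ℝ := P.a i ⬝ᵥ x + P.b i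

/-- The set of solutions of the system of inequalities. -/
def carrier (P : HPolytope n) : Set (Fin n → ℝ) := {x | ∀ i, 0 ≤ P.ell i x}

/-- The intersection of `P` with the facets `F i = {x ∈ P | ⟨a i, x⟩ + b i = 0}`, `i ∈ S`. -/
def face (P : HPolytope n) (S : Set P.ι) : Set (Fin n → ℝ) :=
  {x | x ∈ P.carrier ∧ ∀ i ∈ S, P.ell i x = 0}

/-- The vertices of `P`, that is, the extreme points of the underlying convex set. -/
def vertices (P : HPolytope n) : Set (Fin n → ℝ) := P.carrier.extremePoints ℝ

/-- `P` is a simple convex `n`-dimensional polytope presented without redundant inequalities. -/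
structure IsSimple (P : HPolytope n) : Prop where
  bounded : Bornology.IsBounded P.carrier
  /-- `P` is `n`-dimensional -/
  full_dim : (interior P.carrier).Nonempty
  /-- no inequality can be removed without changing `P` -/
  irredundant : ∀ i, ∃ x, P.ell i x < 0 ∧ ∀ j, j ≠ i → 0 ≤ P.ell j x
  /-- exactly `n` facets meet at each vertex -/
  simple : ∀ x ∈ P.vertices, {i | P.ell i x = 0}.ncard = n

/-- A polytope is flag if every set of pairwise intersecting facets has a common point. -/
def IsFlag (P : HPolytope n) : Prop :=
  ∀ S : Set P.ι, (∀ i ∈ S, ∀ j ∈ S, (P.face {i, j}).Nonempty) → (P.face S).Nonempty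

/-- The product `P × I ⊂ ℝⁿ⁺¹` with the unit segment `I = [0, 1]`: the inequalities of `P` in the
first `n` coordinates, together with `t ≥ 0` (index `inr 0`) and `1 - t ≥ 0` (index `inr 1`) for
the last coordinate `t`. -/
def prodInterval (P : HPolytope n) : HPolytope (n + 1) where
  ι := P.ι ⊕ Fin 2
  fin := inferInstance
  a := Sum.elim (fun i => Fin.snoc (P.a i) 0) ![Fin.snoc 0 1, Fin.snoc 0 (-1)]
  b := Sum.elim P.b ![0, 1]

/-- The intersection of `P` with the additional half-space `⟨c, x⟩ + d ≥ 0` (index `none`). -/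
def cut (P : HPolytope n) (c : Fin n → ℝ) (d : ℝ) : HPolytope n where
  ι := Option P.ι
  fin := inferInstance
  a := fun o => o.elim c P.a
  b := fun o => o.elim d P.b

/-- The hyperplane `⟨c, x⟩ + d = 0` cuts off the face `P.face S`: the vertices of `P` in this face
lie strictly on its negative side, all other vertices of `P` strictly on its positive side. -/
def CutsOff (P : HPolytope n) (S : Set P.ι) (c : Fin n → ℝ) (d : ℝ) : Prop :=
  ∀ v ∈ P.vertices, (v ∈ P.face S → c ⬝ᵥ v + d < 0) ∧ (v ∉ P.face S → 0 < c ⬝ᵥ v + d)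

/-- `Q` is a face cut `fc(P)` of `P`: it is obtained from `P × I` by cutting off
the codimension-two face `F i × {1}` for some facet `F i` of `P`. -/
def IsFaceCut (P : HPolytope n) (Q : HPolytope (n + 1)) : Prop :=
  ∃ (i : P.ι) (c : Fin (n + 1) → ℝ) (d : ℝ),
    P.prodInterval.CutsOff {Sum.inl i, Sum.inr 1} c d ∧ Q = P.prodInterval.cut c d

/-- `P r, P (r + 1), …` is a sequence of iterated face cuts of `F`, that is,
`P n = fc^(n - r)(F)` for `n ≥ r` (for some choice of the facets and of the cutting hyperplanes).
The terms `P n` with `n < r` are irrelevant. -/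
def IsFaceCutSequence {r : ℕ} (F : HPolytope r) (P : ∀ n, HPolytope n) : Prop :=
  P r = F ∧ ∀ n, r ≤ n → IsFaceCut (P n) (P (n + 1))

/-- The moment-angle manifold of `P`: the pullback of `i_P : P → ℝ^m`, `x ↦ (⟨a i, x⟩ + b i)_i`
along `μ : ℂ^m → ℝ^m`, `z ↦ (|z i|²)_i`. -/
def momentAngle (P : HPolytope n) : Set ((Fin n → ℝ) × (P.ι → ℂ)) :=
  {p | p.1 ∈ P.carrier ∧ ∀ i, ‖p.2 i‖ ^ 2 = P.ell i p.1}

/-- The moment-angle manifold of `P` as a topological space. -/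
def Z (P : HPolytope n) : TopCat.{0} := TopCat.of P.momentAngle

end HPolytope

/-! ## Singular cochains and Massey products -/

section Massey

/-- Singular cochains of `X` with coefficients in `R`, written as the family of their homogeneous
components: `f m` is a function on the singular `m`-simplices of `X`. -/
abbrev SingCochain (R : Type*) (X : TopCat.{0}) : Type _ :=
  ∀ m : ℕ, ((TopCat.toSSet.obj X) _⦋m⦌ → R)

variable (R : Type*) [CommRing R] (X : TopCat.{0})

namespace SingCochain

/-- The coboundary `(d f)(σ) = ∑ i, (-1)^i f(∂ᵢ σ)`. -/
def d : SingCochain R X →ₗ[R] SingCochain R X where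
  toFun f
    | 0 => 0
    | m + 1 => fun s => ∑ i : Fin (m + 2), (-1) ^ (i : ℕ) * f m ((TopCat.toSSet.obj X).δ i s)
  map_add' f g := by
    funext m s
    cases m with
    | zero => simp
    | succ m => simp [mul_add, Finset.sum_add_distrib]
  map_smul' r f := by
    funext m s
    cases m with
    | zero => simp
    | succ m => simp [Finset.mul_sum, mul_left_comm]

variable {R X}

/-- The cup product: `(f ∪ g)(σ) = ∑ f(front p-face of σ) * g(back (m - p)-face of σ)`
for an `m`-simplex `σ`, the sum being over `0 ≤ p ≤ m`. -/
def cup (f g : SingCochain R X) : SingCochain R X := fun m s =>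
  ∑ p : Fin (m + 1),
    f p ((TopCat.toSSet.obj X).map (SimplexCategory.subinterval 0 p (by omega)).op s) *
      g (m - p) ((TopCat.toSSet.obj X).map
        (SimplexCategory.subinterval p (m - p) (by omega)).op s)

/-- `bar f = (-1)^(deg f) f`, extended additively to nonhomogeneous cochains. -/
def bar (f : SingCochain R X) : SingCochain R X := fun m s => (-1) ^ m * f m s

/-- `f` is homogeneous of degree `e` (only `0` is homogeneous of negative degree). -/
def IsHomogeneous (f : SingCochain R X) (e : ℤ) : Prop := ∀ m : ℕ, (m : ℤ) ≠ e → f m = 0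

end SingCochain

open SingCochain

/-- The singular cohomology of `X`: cocycles modulo coboundaries. -/
abbrev SingCohomology : Type _ :=
  LinearMap.ker (d R X) ⧸ (LinearMap.range (d R X)).submoduleOf (LinearMap.ker (d R X))

variable {R X}

/-- `f` is a cocycle whose cohomology class is `α`. -/
def Represents (f : SingCochain R X) (α : SingCohomology R X) : Prop :=
  ∃ z : LinearMap.ker (d R X), (z : SingCochain R X) = f ∧ Submodule.Quotient.mk z = α

variable {k : ℕ}

/-- The degree `n_i + … + n_{j-1} - (j - i) + 1` of the entry `c_{i,j}` of a defining system. -/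
def entryDegree (deg : Fin k → ℕ) (i j : Fin (k + 1)) : ℤ :=
  (∑ l : Fin k with i.val ≤ l.val ∧ l.val < j.val, (deg l : ℤ)) - ((j : ℤ) - (i : ℤ)) + 1

/-- `C` is a defining system for the classes `α 0, …, α (k - 1)` of degrees
`deg 0, …, deg (k - 1)`, and `a = a(C)` is the cocycle that it determines. -/
structure IsDefiningSystem (deg : Fin k → ℕ) (α : Fin k → SingCohomology R X)
    (C : Matrix (Fin (k + 1)) (Fin (k + 1)) (SingCochain R X)) (a : SingCochain R X) : Prop where
  zero : ∀ i j, j ≤ i → C i j = 0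
  homogeneous : ∀ i j, i < j → (C i j).IsHomogeneous (entryDegree deg i j)
  represents : ∀ i : Fin k, Represents (C i.castSucc i.succ) (α i)
  /-- `a · E_{1,k+1} = d C - bar C · C` -/
  eq : ∀ i j, (if i = 0 ∧ j = Fin.last k then a else 0) =
    d R X (C i j) - ∑ l, cup (bar (C i l)) (C l j)

/-- The Massey product `⟨α 0, …, α (k - 1)⟩`, as a set of cohomology classes
(it is nonempty if and only if the Massey product is defined). -/
def masseyProduct (deg : Fin k → ℕ) (α : Fin k → SingCohomology R X) :
    Set (SingCohomology R X) :=
  {β | ∃ C a, IsDefiningSystem deg α C a ∧ Represents a β}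

variable (R X) in
/-- There is a nontrivial `k`-fold Massey product `⟨α 0, …, α (k - 1)⟩`, `α i ∈ H^(deg i)(X; R)`,
that is, one which is defined and does not contain `0`. -/
def HasNontrivialMasseyProduct (deg : Fin k → ℕ) : Prop :=
  ∃ α : Fin k → SingCohomology R X,
    (masseyProduct deg α).Nonempty ∧ 0 ∉ masseyProduct deg α

end Massey

end

/-! The moment-angle manifold of a polytope is a retract of that of any of its face cuts. The
truncated face lies in `P × {1}`, so the cutting function `h` is positive on all of `P × {0}`
(`CutsOff.pos_bottom`). Hence `x ↦ (x, 0)` maps `P` into the cut polytope. It lifts to moment-angle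
manifolds by taking the coordinates of the bottom, top and new facets to be `0`, `1` and `√(h (x,
0))` (`toZCut`). Dropping the last coordinate of the base point and the three extra complex
coordinates is a left inverse (`ofZCut`).

Pullback acts on cochains and preserves defining systems. If `f ≫ g = 𝟙`, pulling back along `g`
shows that the product of the classes `g^* α i` is defined. If that product contained `0`, pulling
back along `f` would put `0` in the original product (`HasNontrivialMasseyProduct.of_retract`).

It remains to see that a face cut of a simple flag polytope is again simple and flag
(`CutsOff.isSimple`, `CutsOff.isFlag`), and that face cuts exist when `n > 0`
(`IsSimple.exists_isFaceCut`). Everything then follows by induction on `n`. The convex geometry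
rests on one principle: affine functions attain their minimum over a face at a vertex, so sign
conditions at vertices extend to faces. -/

noncomputable section

/-! ### Naturality of singular cochains and Massey products. -/

namespace SingCochain

variable {R : Type*} [CommRing R] {X Y : TopCat.{0}}

/-- The pullback of singular cochains along a continuous map. -/
def pullback (f : X ⟶ Y) : SingCochain R Y →ₗ[R] SingCochain R X where
  toFun c m s := c m ((TopCat.toSSet.map f).app _ s)
  map_add' _ _ := rfl
  map_smul' _ _ := rfl

lemma pullback_apply (f : X ⟶ Y) (c : SingCochain R Y) (m : ℕ)
    (s : (TopCat.toSSet.obj X) _⦋m⦌) :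
    pullback f c m s = c m ((TopCat.toSSet.map f).app _ s) := rfl

/-- Composing a simplex with `f` commutes definitionally with taking its faces, so here and for the
cup product each degree closes by `rfl`. -/
lemma pullback_d (f : X ⟶ Y) (c : SingCochain R Y) :
    pullback f (d R Y c) = d R X (pullback f c) := by
  funext m s
  cases m with
  | zero => rfl
  | succ m => rfl

lemma pullback_cup (f : X ⟶ Y) (c e : SingCochain R Y) :
    pullback f (cup c e) = cup (pullback f c) (pullback f e) := by
  funext m s
  rfl

lemma pullback_bar (f : X ⟶ Y) (c : SingCochain R Y) :
    pullback f (bar c) = bar (pullback f c) := rfl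

lemma pullback_pullback_of_comp_eq_id {f : X ⟶ Y} {g : Y ⟶ X} (h : f ≫ g = 𝟙 X)
    (c : SingCochain R X) : pullback f (pullback g c) = c := by
  funext m s
  simp only [pullback_apply]
  rw [← NatTrans.comp_app_apply, ← Functor.map_comp, h]
  simp

lemma IsHomogeneous.pullback {c : SingCochain R Y} {e : ℤ} (hc : c.IsHomogeneous e) (f : X ⟶ Y) :
    (pullback f c).IsHomogeneous e := by
  intro m hm
  funext s
  rw [pullback_apply, hc m hm]
  rfl

end SingCochain

open SingCochain

variable {R : Type*} [CommRing R] {X Y : TopCat.{0}}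

/-- The homomorphism induced by a continuous map in singular cohomology. -/
def SingCohomology.map (R : Type*) [CommRing R] {X Y : TopCat.{0}} (f : X ⟶ Y) : SingCohomology R Y →ₗ[R] SingCohomology R X :=
  Submodule.mapQ _ _ ((pullback f).restrict (p := LinearMap.ker (d R Y))
      (q := LinearMap.ker (d R X)) fun c hc => by
        rw [LinearMap.mem_ker] at hc ⊢
        rw [← pullback_d, hc, map_zero]) <| by
    rintro ⟨c, hc⟩ ⟨b, hb⟩
    exact ⟨pullback f b, (pullback_d f b).symm.trans (congrArg (pullback f) hb)⟩

lemma SingCohomology.map_map_of_comp_eq_id {f : X ⟶ Y} {g : Y ⟶ X} (h : f ≫ g = 𝟙 X)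
    (α : SingCohomology R X) : map R f (map R g α) = α := by
  obtain ⟨c, rfl⟩ := Submodule.Quotient.mk_surjective _ α
  exact congrArg Submodule.Quotient.mk (Subtype.ext (pullback_pullback_of_comp_eq_id h c.1))

lemma Represents.pullback {c : SingCochain R Y} {α : SingCohomology R Y} (h : Represents c α)
    (f : X ⟶ Y) : Represents (pullback f c) (SingCohomology.map R f α) := by
  obtain ⟨z, rfl, rfl⟩ := h
  exact ⟨_, rfl, rfl⟩

lemma IsDefiningSystem.pullback {k : ℕ} {deg : Fin k → ℕ} {α : Fin k → SingCohomology R Y}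
    {C : Matrix (Fin (k + 1)) (Fin (k + 1)) (SingCochain R Y)} {a : SingCochain R Y}
    (h : IsDefiningSystem deg α C a) (f : X ⟶ Y) :
    IsDefiningSystem deg (fun i => SingCohomology.map R f (α i))
      (fun i j => SingCochain.pullback f (C i j)) (SingCochain.pullback f a) where
  zero i j hij := by rw [h.zero i j hij, map_zero]
  homogeneous i j hij := (h.homogeneous i j hij).pullback f
  represents i := (h.represents i).pullback f
  eq i j := by
    have := congrArg (SingCochain.pullback f) (h.eq i j)
    simpa only [apply_ite (SingCochain.pullback f), map_sub, map_sum, map_zero, pullback_d,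
      pullback_cup, pullback_bar] using this

lemma map_mem_masseyProduct {k : ℕ} {deg : Fin k → ℕ} {α : Fin k → SingCohomology R Y}
    {β : SingCohomology R Y} (h : β ∈ masseyProduct deg α) (f : X ⟶ Y) :
    SingCohomology.map R f β ∈ masseyProduct deg fun i => SingCohomology.map R f (α i) := by
  obtain ⟨C, a, hC, ha⟩ := h
  exact ⟨_, _, hC.pullback f, ha.pullback f⟩

/-- Nontrivial Massey products of a retract are nontrivial Massey products of the whole space. -/
lemma HasNontrivialMasseyProduct.of_retract {k : ℕ} {deg : Fin k → ℕ} {f : X ⟶ Y} {g : Y ⟶ X}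
    (h : f ≫ g = 𝟙 X) (hX : HasNontrivialMasseyProduct R X deg) :
    HasNontrivialMasseyProduct R Y deg := by
  obtain ⟨α, ⟨β, hβ⟩, h0⟩ := hX
  refine ⟨fun i => SingCohomology.map R g (α i), ⟨_, map_mem_masseyProduct hβ g⟩, fun h1 => h0 ?_⟩
  have h2 := map_mem_masseyProduct h1 f
  simpa only [map_zero, SingCohomology.map_map_of_comp_eq_id h] using h2

end

noncomputable section

/-! ### Vertices and faces of polytopes given by inequalities. -/

namespace HPolytope

variable {n : ℕ} {P : HPolytope n}

lemma ell_add_smul (P : HPolytope n) (i : P.ι) (x u : Fin n → ℝ) (t : ℝ) :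
    P.ell i (x + t • u) = P.ell i x + t * (P.a i ⬝ᵥ u) := by
  simp only [ell, dotProduct_add, dotProduct_smul, smul_eq_mul]
  ring

lemma ell_comb (P : HPolytope n) (i : P.ι) (x y : Fin n → ℝ) {s t : ℝ} (h : s + t = 1) :
    P.ell i (s • x + t • y) = s * P.ell i x + t * P.ell i y := by
  simp only [ell, dotProduct_add, dotProduct_smul, smul_eq_mul]
  linear_combination -(P.b i) * h

lemma continuous_ell (P : HPolytope n) (i : P.ι) : Continuous (P.ell i) := by
  unfold ell
  fun_prop

lemma isClosed_carrier (P : HPolytope n) : IsClosed P.carrier := by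
  simp only [carrier, Set.ofPred_forall]
  exact isClosed_iInter fun i => isClosed_le continuous_const (P.continuous_ell i)

lemma isClosed_face (P : HPolytope n) (S : Set P.ι) : IsClosed (P.face S) := by
  have : P.face S = P.carrier ∩ ⋂ i ∈ S, {x | P.ell i x = 0} := by
    ext x
    simp [face]
  rw [this]
  exact P.isClosed_carrier.inter <| isClosed_biInter fun i _ =>
    isClosed_eq (P.continuous_ell i) continuous_const

lemma isCompact_face (hP : Bornology.IsBounded P.carrier) (S : Set P.ι) :
    IsCompact (P.face S) :=
  Metric.isCompact_of_isClosed_isBounded (P.isClosed_face S) (hP.subset fun _ hx => hx.1)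

lemma comb_mem_face {S : Set P.ι} {x y : Fin n → ℝ} (hx : x ∈ P.face S) (hy : y ∈ P.face S)
    {s t : ℝ} (hs : 0 ≤ s) (ht : 0 ≤ t) (h : s + t = 1) : s • x + t • y ∈ P.face S := by
  refine ⟨fun i => ?_, fun i hi => ?_⟩
  · rw [P.ell_comb i x y h]
    exact add_nonneg (mul_nonneg hs (hx.1 i)) (mul_nonneg ht (hy.1 i))
  · rw [P.ell_comb i x y h, hx.2 i hi, hy.2 i hi, mul_zero, mul_zero, add_zero]

/-- Small moves in directions along which the active constraints do not decrease stay in `P`. -/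
lemma exists_pos_add_smul_mem {x u : Fin n → ℝ} (hx : x ∈ P.carrier)
    (hu : ∀ i, P.ell i x = 0 → 0 ≤ P.a i ⬝ᵥ u) : ∃ ε : ℝ, 0 < ε ∧ x + ε • u ∈ P.carrier := by
  have key : ∀ i, ∀ᶠ ε in nhdsWithin (0 : ℝ) (Set.Ioi 0), 0 ≤ P.ell i (x + ε • u) := by
    intro i
    rcases (hx i).eq_or_lt with h0 | h0
    · filter_upwards [self_mem_nhdsWithin] with ε hε
      rw [ell_add_smul, ← h0, zero_add]
      exact mul_nonneg (le_of_lt hε) (hu i h0.symm)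
    · have hc : Continuous fun ε : ℝ => P.ell i (x + ε • u) :=
        (P.continuous_ell i).comp (by fun_prop)
      have h1 : Filter.Tendsto (fun ε : ℝ => P.ell i (x + ε • u)) (nhds 0) (nhds (P.ell i x)) := by
        simpa using hc.tendsto 0
      exact ((h1.eventually_const_lt h0).filter_mono nhdsWithin_le_nhds).mono fun _ h => h.le
  obtain ⟨ε, hε, hpos⟩ := ((Filter.eventually_all.2 key).and self_mem_nhdsWithin).exists
  exact ⟨ε, hpos, hε⟩

/-- A point is a vertex iff the active constraints determine it. -/
lemma mem_vertices_iff {x : Fin n → ℝ} : x ∈ P.vertices ↔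
    x ∈ P.carrier ∧ ∀ u, (∀ i, P.ell i x = 0 → P.a i ⬝ᵥ u = 0) → u = 0 := by
  constructor
  · intro hx
    refine ⟨hx.1, fun u hu => ?_⟩
    obtain ⟨ε, hε, h1⟩ := exists_pos_add_smul_mem hx.1 fun i hi => (hu i hi).ge
    obtain ⟨δ, hδ, h2⟩ := exists_pos_add_smul_mem (u := -u) hx.1 fun i hi => by
      rw [dotProduct_neg, hu i hi, neg_zero]
    -- With these weights the `u`-terms of `x + ε u` and `x - δ u` cancel, so `x` lies strictly
    -- between two points of `P`.
    have h3 := (mem_extremePoints_iff_left.1 hx).2 _ h1 _ h2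
      ⟨δ / (ε + δ), ε / (ε + δ), by positivity, by positivity, by field_simp; ring, by
        ext j
        simp only [Pi.add_apply, Pi.smul_apply, Pi.neg_apply, smul_eq_mul]
        field_simp
        ring⟩
    have h4 : ε • u = 0 := by simpa using h3
    exact (smul_eq_zero.1 h4).resolve_left hε.ne'
  · rintro ⟨hx, hu⟩
    refine mem_extremePoints_iff_left.2 ⟨hx, ?_⟩
    rintro y hy z hz ⟨s, t, hs, ht, hst, rfl⟩
    refine sub_eq_zero.1 (hu _ fun i hi => ?_)
    have h1 : P.ell i y = 0 := by
      rw [ell_comb P i y z hst] at hi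
      nlinarith [mul_nonneg hs.le (hy i), mul_nonneg ht.le (hz i), hy i]
    simp only [ell] at h1 hi
    rw [dotProduct_sub]
    linarith

/-- An affine function on a nonempty face attains its minimum at a vertex. -/
lemma exists_vertex_forall_le (hP : Bornology.IsBounded P.carrier) {S : Set P.ι}
    (hS : (P.face S).Nonempty) (c : Fin n → ℝ) :
    ∃ v ∈ P.vertices, v ∈ P.face S ∧ ∀ x ∈ P.face S, c ⬝ᵥ v ≤ c ⬝ᵥ x := by
  have hcont : Continuous fun x : Fin n → ℝ => c ⬝ᵥ x := by fun_prop
  obtain ⟨w, hw, hmin⟩ := (isCompact_face hP S).exists_isMinOn hS hcont.continuousOn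
  have hmin' : ∀ x ∈ P.face S, c ⬝ᵥ w ≤ c ⬝ᵥ x := fun x hx => hmin hx
  have hT : IsCompact (P.face S ∩ {x | c ⬝ᵥ x = c ⬝ᵥ w}) :=
    (isCompact_face hP S).inter_right (isClosed_eq hcont continuous_const)
  -- The minimisers form a compact set, which has an extreme point. A segment of `P` with an
  -- interior point in this set has both ends in it, so `v` is extreme in `P` too.
  obtain ⟨v, ⟨hvS, hvw : c ⬝ᵥ v = c ⬝ᵥ w⟩, hv⟩ := hT.extremePoints_nonempty ⟨w, hw, rfl⟩
  refine ⟨v, mem_extremePoints_iff_left.2 ⟨hvS.1, ?_⟩, hvS, fun x hx => hvw ▸ hmin' x hx⟩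
  rintro y hy z hz ⟨s, t, hs, ht, hst, rfl⟩
  have hface : y ∈ P.face S ∧ z ∈ P.face S := by
    refine ⟨⟨hy, fun i hi => ?_⟩, ⟨hz, fun i hi => ?_⟩⟩ <;>
    · have h1 := hvS.2 i hi
      rw [ell_comb P i y z hst] at h1
      nlinarith [mul_nonneg hs.le (hy i), mul_nonneg ht.le (hz i), hy i, hz i]
  have hyw := hmin' y hface.1
  have hzw := hmin' z hface.2
  have hval : s * (c ⬝ᵥ y) + t * (c ⬝ᵥ z) = c ⬝ᵥ w := by
    simpa [dotProduct_add, dotProduct_smul] using hvw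
  have hw1 : c ⬝ᵥ w = s * (c ⬝ᵥ w) + t * (c ⬝ᵥ w) := by rw [← add_mul, hst, one_mul]
  exact hv ⟨hface.1, show c ⬝ᵥ y = c ⬝ᵥ w by nlinarith⟩
    ⟨hface.2, show c ⬝ᵥ z = c ⬝ᵥ w by nlinarith⟩ ⟨s, t, hs, ht, hst, rfl⟩

lemma exists_vertex_mem_face (hP : Bornology.IsBounded P.carrier) {S : Set P.ι}
    (hS : (P.face S).Nonempty) : ∃ v ∈ P.vertices, v ∈ P.face S :=
  let ⟨v, hv, hvS, _⟩ := exists_vertex_forall_le hP hS 0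
  ⟨v, hv, hvS⟩

/-- This turns `CutsOff`, a condition on vertices only, into information about whole faces. -/
lemma pos_on_face (hP : Bornology.IsBounded P.carrier) {S : Set P.ι} {c : Fin n → ℝ} {d : ℝ}
    (h : ∀ v ∈ P.vertices, v ∈ P.face S → 0 < c ⬝ᵥ v + d) {x : Fin n → ℝ} (hx : x ∈ P.face S) :
    0 < c ⬝ᵥ x + d := by
  obtain ⟨v, hv, hvS, hle⟩ := exists_vertex_forall_le hP ⟨x, hx⟩ c
  linarith [h v hv hvS, hle x hx]

lemma neg_on_face (hP : Bornology.IsBounded P.carrier) {S : Set P.ι} {c : Fin n → ℝ} {d : ℝ}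
    (h : ∀ v ∈ P.vertices, v ∈ P.face S → c ⬝ᵥ v + d < 0) {x : Fin n → ℝ} (hx : x ∈ P.face S) :
    c ⬝ᵥ x + d < 0 := by
  have := pos_on_face hP (c := -c) (d := -d)
    (fun v hv hvS => by rw [neg_dotProduct]; linarith [h v hv hvS]) hx
  rw [neg_dotProduct] at this
  linarith

/-- A vertex is determined by its set of active constraints. Finiteness later allows one `ε` to
serve all vertices. -/
lemma finite_vertices (P : HPolytope n) : P.vertices.Finite := by
  refine Set.Finite.of_injOn (f := fun x => {i | P.ell i x = 0}) (t := Set.univ)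
    (fun _ _ => Set.mem_univ _) (fun x hx y hy hxy => ?_) Set.finite_univ
  refine sub_eq_zero.1 ((mem_vertices_iff.1 hx).2 _ fun i hi => ?_)
  have hi' : P.ell i y = 0 := (Set.ext_iff.1 hxy i).1 hi
  simp only [ell] at hi hi'
  rw [dotProduct_sub]
  linarith

/-- Fewer than `n` linear forms on `ℝⁿ` have a common nonzero kernel vector. -/
lemma le_ncard_of_forall_eq_zero {ι : Type*} [Finite ι] (a : ι → Fin n → ℝ) (A : Set ι)
    (h : ∀ u, (∀ i ∈ A, a i ⬝ᵥ u = 0) → u = 0) : n ≤ A.ncard := by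
  classical
  have : Fintype A := Fintype.ofFinite A
  let f : (Fin n → ℝ) →ₗ[ℝ] (A → ℝ) := LinearMap.pi fun i => dotProductBilin ℝ ℝ (a i)
  have hf : Function.Injective f := by
    rw [← LinearMap.ker_eq_bot, LinearMap.ker_eq_bot']
    exact fun u hu => h u fun i hi => congrFun hu ⟨i, hi⟩
  have := LinearMap.finrank_le_finrank_of_injective hf
  rwa [Module.finrank_fin_fun, Module.finrank_fintype_fun_eq_card, ← Nat.card_eq_fintype_card,
    Nat.card_coe_set_eq] at this

/-- At a vertex of a simple polytope, one may leave a single facet along the other ones. -/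
lemma IsSimple.exists_dir (hP : P.IsSimple) {v : Fin n → ℝ} (hv : v ∈ P.vertices) {i : P.ι}
    (hi : P.ell i v = 0) : ∃ u, 0 < P.a i ⬝ᵥ u ∧ ∀ j, P.ell j v = 0 → j ≠ i → P.a j ⬝ᵥ u = 0 := by
  by_contra! hcon
  -- Without such a direction, a vector killed by the other active forms is killed by `P.a i` as
  -- well (else it or its negative would serve), hence is zero. Then `n - 1` forms would determine a
  -- point of `ℝⁿ`.
  have hle := le_ncard_of_forall_eq_zero P.a ({j | P.ell j v = 0} \ {i}) fun u hu => by
    refine (mem_vertices_iff.1 hv).2 u fun j hj => ?_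
    by_cases hji : j = i
    · subst hji
      by_contra hne
      rcases lt_or_gt_of_ne hne with hlt | hgt
      · obtain ⟨l, hl, hlj, h0⟩ := hcon (-u) (by rw [dotProduct_neg]; linarith)
        exact h0 (by rw [dotProduct_neg, hu l ⟨hl, hlj⟩, neg_zero])
      · obtain ⟨l, hl, hlj, h0⟩ := hcon u hgt
        exact h0 (hu l ⟨hl, hlj⟩)
    · exact hu j ⟨hj, hji⟩
  have hlt := Set.ncard_sdiff_singleton_lt_of_mem (s := {j | P.ell j v = 0}) hi
  rw [hP.simple v hv] at hlt
  omega

/-- A nonempty face of a simple polytope is not contained in a facet that does not define it. -/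
lemma IsSimple.exists_vertex_not_mem (hP : P.IsSimple) {S : Set P.ι} (hS : (P.face S).Nonempty)
    {i : P.ι} (hi : i ∉ S) : ∃ v ∈ P.vertices, v ∈ P.face S ∧ 0 < P.ell i v := by
  -- Take `v` maximising `P.ell i` on the face. If the maximum were `0`, leaving facet `i` along the
  -- other active facets would stay in the face, as `i ∉ S`, and increase `P.ell i`.
  obtain ⟨v, hv, hvS, hmax⟩ := exists_vertex_forall_le hP.bounded hS (-P.a i)
  refine ⟨v, hv, hvS, lt_of_le_of_ne (hvS.1 i) fun h0 => ?_⟩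
  obtain ⟨u, hu, hu0⟩ := hP.exists_dir hv h0.symm
  obtain ⟨ε, hε, hmem⟩ := exists_pos_add_smul_mem (u := u) hvS.1 fun j hj => by
    by_cases hji : j = i
    · exact hji ▸ hu.le
    · exact (hu0 j hj hji).ge
  have hle := hmax (v + ε • u) ⟨hmem, fun j hj => by
    rw [ell_add_smul, hvS.2 j hj, hu0 j (hvS.2 j hj) (fun h => hi (h ▸ hj)), mul_zero, add_zero]⟩
  simp only [neg_dotProduct, dotProduct_add, dotProduct_smul, smul_eq_mul] at hle
  nlinarith [mul_pos hε hu]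

lemma face_empty (P : HPolytope n) : P.face ∅ = P.carrier := by simp [face]

lemma IsSimple.carrier_nonempty (hP : P.IsSimple) : P.carrier.Nonempty :=
  hP.full_dim.mono interior_subset

/-- Any interior point works: if constraint `i` were active there, a small step towards a point
violating `i` would violate it inside `P`. -/
lemma IsSimple.exists_forall_pos (hP : P.IsSimple) : ∃ x, ∀ i, 0 < P.ell i x := by
  obtain ⟨x, hx⟩ := hP.full_dim
  refine ⟨x, fun i => lt_of_le_of_ne (interior_subset hx i) fun h0 => ?_⟩
  obtain ⟨y, hy, -⟩ := hP.irredundant i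
  have hc : Continuous fun t : ℝ => x + t • (y - x) := by fun_prop
  have h1 : ∀ᶠ t in nhdsWithin (0 : ℝ) (Set.Ioi 0), x + t • (y - x) ∈ P.carrier := by
    refine nhdsWithin_le_nhds (hc.tendsto 0 ?_)
    simpa using mem_interior_iff_mem_nhds.1 hx
  obtain ⟨t, ht, ht0 : 0 < t⟩ := (h1.and self_mem_nhdsWithin).exists
  have h2 := ht i
  rw [ell_add_smul, ← h0, zero_add, dotProduct_sub] at h2
  simp only [ell] at hy h0
  nlinarith [mul_pos ht0 (show 0 < -(P.a i ⬝ᵥ y + P.b i) by linarith)]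

lemma interior_nonempty_of_forall_pos {x : Fin n → ℝ} (hx : ∀ i, 0 < P.ell i x) :
    (interior P.carrier).Nonempty := by
  refine ⟨x, mem_interior_iff_mem_nhds.2 ?_⟩
  have : ∀ᶠ y in nhds x, ∀ i, 0 < P.ell i y := Filter.eventually_all.2 fun i =>
    ((P.continuous_ell i).tendsto x).eventually_const_lt (hx i)
  exact this.mono fun y hy i => (hy i).le

/-- Facets of a simple polytope are nonempty, and one can leave the polytope through a given facet
only, staying as close to it as desired. -/
lemma IsSimple.exists_facet_crossing (hP : P.IsSimple) (i : P.ι) :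
    ∃ x u, x ∈ P.face {i} ∧
      ∀ᶠ t in nhdsWithin (0 : ℝ) (Set.Ioi 0), P.ell i (x + t • u) < 0 ∧
        ∀ j, j ≠ i → 0 ≤ P.ell j (x + t • u) := by
  obtain ⟨p, hp⟩ := hP.exists_forall_pos
  obtain ⟨y, hy, hy'⟩ := hP.irredundant i
  have hpi := hp i
  -- The parameter at which the segment from the interior point `p` to `y`, which violates only `i`,
  -- crosses facet `i`.
  set s := P.ell i p / (P.ell i p - P.ell i y) with hs
  have hden : 0 < P.ell i p - P.ell i y := by linarith
  have hs0 : 0 < s := by positivity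
  have hs1 : s < 1 := (div_lt_one hden).2 (by linarith)
  have hell : ∀ (j : P.ι) (t : ℝ), P.ell j (p + t • (y - p)) =
      (1 - t) * P.ell j p + t * P.ell j y := by
    intro j t
    rw [ell_add_smul, dotProduct_sub]
    simp only [ell]
    ring
  have hsi : (1 - s) * P.ell i p + s * P.ell i y = 0 := by
    rw [hs]
    field_simp
    ring
  refine ⟨p + s • (y - p), y - p, ⟨fun j => ?_, ?_⟩, ?_⟩
  · rw [hell]
    by_cases hji : j = i
    · rw [hji, hsi]
    · exact add_nonneg (mul_nonneg (by linarith) (hp j).le) (mul_nonneg hs0.le (hy' j hji))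
  · rintro j rfl
    rw [hell, hsi]
  · filter_upwards [Ioo_mem_nhdsGT (show (0 : ℝ) < 1 - s by linarith)] with t ht
    rw [add_assoc, ← add_smul]
    refine ⟨?_, fun j hj => ?_⟩
    · rw [hell]
      nlinarith [mul_pos ht.1 hden]
    · rw [hell]
      exact add_nonneg (mul_nonneg (by linarith [ht.2]) (hp j).le)
        (mul_nonneg (by linarith [ht.1]) (hy' j hj))

end HPolytope

end

noncomputable section

/-! ### Products with an interval and hyperplane cuts. -/

namespace HPolytope

variable {n : ℕ} {P : HPolytope n}

/-- The facet `F i × I` of `P × I`. -/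
def side (P : HPolytope n) (i : P.ι) : P.prodInterval.ι := Sum.inl i

/-- The facet `P × 0` of `P × I`. -/
def bottom (P : HPolytope n) : P.prodInterval.ι := Sum.inr 0

/-- The facet `P × 1` of `P × I`. -/
def top (P : HPolytope n) : P.prodInterval.ι := Sum.inr 1

/-- The constraint of `P.cut c d` inherited from a constraint of `P`. -/
def oldFacet {c : Fin n → ℝ} {d : ℝ} (i : P.ι) : (P.cut c d).ι := some i

/-- The additional constraint of `P.cut c d`. -/
def newFacet {c : Fin n → ℝ} {d : ℝ} : (P.cut c d).ι := none

lemma side_injective (P : HPolytope n) : Function.Injective P.side := Sum.inl_injective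

lemma oldFacet_injective {c : Fin n → ℝ} {d : ℝ} :
    Function.Injective (oldFacet (P := P) (c := c) (d := d)) := Option.some_injective _

@[simp] lemma side_inj {i j : P.ι} : P.side i = P.side j ↔ i = j := P.side_injective.eq_iff

@[simp] lemma side_ne_bottom (i : P.ι) : P.side i ≠ P.bottom := Sum.inl_ne_inr

@[simp] lemma side_ne_top (i : P.ι) : P.side i ≠ P.top := Sum.inl_ne_inr

@[simp] lemma bottom_ne_top : P.bottom ≠ P.top := fun h => zero_ne_one (Sum.inr_injective h)

@[simp] lemma bottom_ne_side (i : P.ι) : P.bottom ≠ P.side i := Sum.inr_ne_inl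

lemma top_ne_side (i : P.ι) : P.top ≠ P.side i := Sum.inr_ne_inl

@[simp] lemma top_ne_bottom : P.top ≠ P.bottom := bottom_ne_top.symm

@[simp] lemma oldFacet_inj {c : Fin n → ℝ} {d : ℝ} {i j : P.ι} :
    (oldFacet i : (P.cut c d).ι) = oldFacet j ↔ i = j := oldFacet_injective.eq_iff

@[simp] lemma oldFacet_ne_newFacet {c : Fin n → ℝ} {d : ℝ} (i : P.ι) :
    (oldFacet i : (P.cut c d).ι) ≠ newFacet := Option.some_ne_none i

lemma dotProduct_snoc (a : Fin n → ℝ) (s : ℝ) (y : Fin (n + 1) → ℝ) :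
    (Fin.snoc a s : Fin (n + 1) → ℝ) ⬝ᵥ y = a ⬝ᵥ Fin.init y + s * y (Fin.last n) := by
  simp [dotProduct, Fin.sum_univ_castSucc, Fin.init]

lemma dotProduct_snoc_right (c : Fin (n + 1) → ℝ) (x : Fin n → ℝ) (t : ℝ) :
    c ⬝ᵥ (Fin.snoc x t : Fin (n + 1) → ℝ) = Fin.init c ⬝ᵥ x + c (Fin.last n) * t := by
  simp [dotProduct, Fin.sum_univ_castSucc, Fin.init]

lemma prodInterval_ell_inl (P : HPolytope n) (i : P.ι) (y : Fin (n + 1) → ℝ) :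
    P.prodInterval.ell (P.side i) y = P.ell i (Fin.init y) := by
  change (Fin.snoc (P.a i) 0 : Fin (n + 1) → ℝ) ⬝ᵥ y + P.b i = _
  rw [dotProduct_snoc, zero_mul, add_zero]
  rfl

lemma prodInterval_ell_zero (P : HPolytope n) (y : Fin (n + 1) → ℝ) :
    P.prodInterval.ell P.bottom y = y (Fin.last n) := by
  change (Fin.snoc 0 1 : Fin (n + 1) → ℝ) ⬝ᵥ y + 0 = _
  simp [dotProduct_snoc]

lemma prodInterval_ell_one (P : HPolytope n) (y : Fin (n + 1) → ℝ) :
    P.prodInterval.ell P.top y = 1 - y (Fin.last n) := by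
  change (Fin.snoc 0 (-1) : Fin (n + 1) → ℝ) ⬝ᵥ y + 1 = _
  rw [dotProduct_snoc, zero_dotProduct]
  ring

lemma prodInterval_forall {p : P.prodInterval.ι → Prop} :
    (∀ o, p o) ↔ (∀ i, p (P.side i)) ∧ p P.bottom ∧ p P.top :=
  Sum.forall.trans (and_congr Iff.rfl Fin.forall_fin_two)

lemma mem_prodInterval_face {S : Set P.prodInterval.ι} {y : Fin (n + 1) → ℝ} :
    y ∈ P.prodInterval.face S ↔ Fin.init y ∈ P.face {i | P.side i ∈ S} ∧
      (0 ≤ y (Fin.last n) ∧ (P.bottom ∈ S → y (Fin.last n) = 0)) ∧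
      y (Fin.last n) ≤ 1 ∧ (P.top ∈ S → y (Fin.last n) = 1) := by
  simp only [face, carrier, Set.mem_ofPred_eq, prodInterval_forall, prodInterval_ell_inl,
    prodInterval_ell_zero, prodInterval_ell_one, sub_nonneg, sub_eq_zero, @eq_comm ℝ 1]
  tauto

lemma cut_ell_some (P : HPolytope n) (c : Fin n → ℝ) (d : ℝ) (i : P.ι) :
    (P.cut c d).ell (oldFacet i) = P.ell i := rfl

lemma cut_ell_none (P : HPolytope n) (c : Fin n → ℝ) (d : ℝ) (x : Fin n → ℝ) :
    (P.cut c d).ell newFacet x = c ⬝ᵥ x + d := rfl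

lemma cut_forall {c : Fin n → ℝ} {d : ℝ} {p : (P.cut c d).ι → Prop} :
    (∀ o, p o) ↔ p newFacet ∧ ∀ i : P.ι, p (oldFacet i) := Option.forall

lemma mem_cut_face {c : Fin n → ℝ} {d : ℝ} {S : Set (P.cut c d).ι} {x : Fin n → ℝ} :
    x ∈ (P.cut c d).face S ↔
      x ∈ P.face {i | oldFacet i ∈ S} ∧ 0 ≤ c ⬝ᵥ x + d ∧ (newFacet ∈ S → c ⬝ᵥ x + d = 0) := by
  simp only [face, carrier, Set.mem_ofPred_eq, cut_forall, cut_ell_some, cut_ell_none]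
  tauto

lemma mem_cut_carrier {c : Fin n → ℝ} {d : ℝ} {x : Fin n → ℝ} :
    x ∈ (P.cut c d).carrier ↔ x ∈ P.carrier ∧ 0 ≤ c ⬝ᵥ x + d := by
  simp only [carrier, Set.mem_ofPred_eq, cut_forall, cut_ell_some, cut_ell_none]
  tauto

lemma mem_prodInterval_carrier {y : Fin (n + 1) → ℝ} :
    y ∈ P.prodInterval.carrier ↔
      Fin.init y ∈ P.carrier ∧ 0 ≤ y (Fin.last n) ∧ y (Fin.last n) ≤ 1 := by
  simp only [carrier, Set.mem_ofPred_eq, prodInterval_forall, prodInterval_ell_inl,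
    prodInterval_ell_zero, prodInterval_ell_one, sub_nonneg]

lemma isBounded_prodInterval (hP : Bornology.IsBounded P.carrier) :
    Bornology.IsBounded P.prodInterval.carrier := by
  have hc : IsCompact P.carrier := Metric.isCompact_of_isClosed_isBounded P.isClosed_carrier hP
  have hcont : Continuous fun p : (Fin n → ℝ) × ℝ => (Fin.snoc p.1 p.2 : Fin (n + 1) → ℝ) :=
    Continuous.finSnoc (A := fun _ => ℝ) continuous_fst continuous_snd
  refine ((hc.prod (isCompact_Icc (a := (0 : ℝ)) (b := 1))).image hcont).isBounded.subset fun y hy =>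
    ⟨(Fin.init y, y (Fin.last n)), ?_, Fin.snoc_init_self y⟩
  obtain ⟨h1, h2, h3⟩ := mem_prodInterval_carrier.1 hy
  exact ⟨h1, h2, h3⟩

lemma mem_prodInterval_vertices {y : Fin (n + 1) → ℝ} :
    y ∈ P.prodInterval.vertices ↔
      Fin.init y ∈ P.vertices ∧ (y (Fin.last n) = 0 ∨ y (Fin.last n) = 1) := by
  have ha : ∀ (i : P.ι) (u : Fin (n + 1) → ℝ),
      P.prodInterval.a (P.side i) ⬝ᵥ u = P.a i ⬝ᵥ Fin.init u := fun i u =>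
    (dotProduct_snoc (P.a i) 0 u).trans (by ring)
  have h0 : ∀ u : Fin (n + 1) → ℝ,
      P.prodInterval.a P.bottom ⬝ᵥ u = u (Fin.last n) := fun u =>
    (dotProduct_snoc 0 1 u).trans (by rw [zero_dotProduct]; ring)
  have h1 : ∀ u : Fin (n + 1) → ℝ,
      P.prodInterval.a P.top ⬝ᵥ u = -u (Fin.last n) := fun u =>
    (dotProduct_snoc 0 (-1) u).trans (by rw [zero_dotProduct]; ring)
  simp only [mem_vertices_iff, mem_prodInterval_carrier, prodInterval_forall, ha, h0, h1,
    prodInterval_ell_inl, prodInterval_ell_zero, prodInterval_ell_one, sub_eq_zero, neg_eq_zero]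
  constructor
  · rintro ⟨⟨hy, -⟩, hu⟩
    refine ⟨⟨hy, fun u hu' => ?_⟩, ?_⟩
    · have := hu (Fin.snoc u 0) ⟨by simpa using hu', by simp, by simp⟩
      funext j
      simpa using congrFun this j.castSucc
    -- Away from heights `0` and `1`, the vertical direction is killed by every active form.
    · by_contra! hcon
      have := hu (Fin.snoc 0 1) ⟨by simp, fun h => absurd h hcon.1, fun h => absurd h.symm hcon.2⟩
      simpa using congrFun this (Fin.last n)
  · rintro ⟨⟨hy, hu⟩, ht⟩
    refine ⟨⟨hy, ?_, ?_⟩, fun u ⟨hu1, hu2, hu3⟩ => ?_⟩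
    · rcases ht with h | h <;> norm_num [h]
    · rcases ht with h | h <;> norm_num [h]
    · rw [← Fin.snoc_init_self u, hu _ hu1, ht.elim hu2 fun h => hu3 h.symm]
      funext j
      refine Fin.lastCases ?_ (fun j => ?_) j <;> simp

lemma IsSimple.ncard_prodInterval (hP : P.IsSimple) {y : Fin (n + 1) → ℝ}
    (hy : y ∈ P.prodInterval.vertices) : {o | P.prodInterval.ell o y = 0}.ncard = n + 1 := by
  obtain ⟨hv, ht⟩ := mem_prodInterval_vertices.1 hy
  obtain ⟨e, hes, he⟩ : ∃ e, (∀ i, e ≠ P.side i) ∧ {o | P.prodInterval.ell o y = 0} =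
      insert e (P.side '' {i | P.ell i (Fin.init y) = 0}) := by
    rcases ht with h | h
    · refine ⟨P.bottom, bottom_ne_side, Set.ext (prodInterval_forall.2 ⟨fun i => ?_, ?_, ?_⟩)⟩
      · simp [prodInterval_ell_inl]
      · simp [prodInterval_ell_zero, h]
      · simp [prodInterval_ell_one, h]
    · refine ⟨P.top, top_ne_side, Set.ext (prodInterval_forall.2 ⟨fun i => ?_, ?_, ?_⟩)⟩
      · simp [prodInterval_ell_inl]
      · simp [prodInterval_ell_zero, h]
      · simp [prodInterval_ell_one, h]
  rw [he, Set.ncard_insert_of_notMem (by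
      rintro ⟨i, -, hi⟩
      exact hes i hi.symm) (Set.toFinite _),
    Set.ncard_image_of_injective _ P.side_injective, hP.simple _ hv]

/-- Cutting a bounded polyhedron with simple vertices by a hyperplane that avoids the vertices
produces a polyhedron with simple vertices. -/
lemma ncard_cut (hP : Bornology.IsBounded P.carrier)
    (hs : ∀ x ∈ P.vertices, {i | P.ell i x = 0}.ncard = n) {c : Fin n → ℝ} {d : ℝ}
    (hcd : ∀ v ∈ P.vertices, c ⬝ᵥ v + d ≠ 0) {w : Fin n → ℝ} (hw : w ∈ (P.cut c d).vertices) :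
    {o | (P.cut c d).ell o w = 0}.ncard = n := by
  obtain ⟨hwc, hwu⟩ := mem_vertices_iff.1 hw
  have hwP := (mem_cut_carrier.1 hwc).1
  simp only [cut_forall, cut_ell_none, cut_ell_some] at hwu
  by_cases h0 : c ⬝ᵥ w + d = 0
  · have hset : {o | (P.cut c d).ell o w = 0} = insert newFacet (oldFacet '' {i | P.ell i w = 0}) := by
      refine Set.ext (cut_forall.2 ⟨?_, fun i => ?_⟩)
      · simp [cut_ell_none, h0]
      · simp [cut_ell_some]
    have hcard : {o | (P.cut c d).ell o w = 0}.ncard = {i | P.ell i w = 0}.ncard + 1 := by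
      rw [hset, Set.ncard_insert_of_notMem (by simp) (Set.toFinite _),
        Set.ncard_image_of_injective _ oldFacet_injective]
    have hge := le_ncard_of_forall_eq_zero (P.cut c d).a {o | (P.cut c d).ell o w = 0}
      fun u hu => (mem_vertices_iff.1 hw).2 u hu
    -- The smallest face of `P` containing `w` has a vertex `v`, with strictly more active
    -- constraints since `w` lies on the hyperplane and so is no vertex of `P`. Thus fewer than `n`
    -- old constraints are active at `w`; `hge` gives at least `n - 1`.
    obtain ⟨v, hv, hvw⟩ := exists_vertex_mem_face hP (S := {i | P.ell i w = 0})
      ⟨w, hwP, fun i hi => hi⟩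
    have hsub : {i | P.ell i w = 0} ⊆ {i | P.ell i v = 0} := hvw.2
    have hne : {i | P.ell i w = 0} ≠ {i | P.ell i v = 0} := fun heq =>
      hcd w (mem_vertices_iff.2 ⟨hwP, fun u hu => (mem_vertices_iff.1 hv).2 u fun i hi =>
        hu i (heq.symm.subset hi)⟩) h0
    have hlt := Set.ncard_lt_ncard (hsub.ssubset_of_ne hne) (Set.toFinite _)
    rw [hs v hv] at hlt
    omega
  · have hset : {o | (P.cut c d).ell o w = 0} = oldFacet '' {i | P.ell i w = 0} := by
      refine Set.ext (cut_forall.2 ⟨?_, fun i => ?_⟩)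
      · simp [cut_ell_none, h0]
      · simp [cut_ell_some]
    rw [hset, Set.ncard_image_of_injective _ oldFacet_injective]
    refine hs w ?_
    exact mem_vertices_iff.2 ⟨hwP, fun u hu => hwu u ⟨fun h => absurd h h0, hu⟩⟩

lemma exists_mem_face_eq_zero {S : Set P.ι} {x y c : Fin n → ℝ} {d : ℝ} (hx : x ∈ P.face S)
    (hy : y ∈ P.face S) (hxc : c ⬝ᵥ x + d < 0) (hyc : 0 < c ⬝ᵥ y + d) :
    ∃ z ∈ P.face S, c ⬝ᵥ z + d = 0 := by
  have hden : 0 < (c ⬝ᵥ y + d) - (c ⬝ᵥ x + d) := by linarith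
  refine ⟨_, comb_mem_face hx hy
    (div_nonneg hyc.le hden.le) (div_nonneg (neg_nonneg.2 hxc.le) hden.le)
    (by rw [← add_div, div_eq_one_iff_eq hden.ne']; ring), ?_⟩
  simp only [dotProduct_add, dotProduct_smul, smul_eq_mul]
  field_simp
  ring

/-! ### Face cuts: flagness, simplicity and the retraction. -/

section FaceCut

variable {i : P.ι} {c : Fin (n + 1) → ℝ} {d : ℝ}

lemma CutsOff.neg (hP : P.IsSimple) (h : P.prodInterval.CutsOff {P.side i, P.top} c d)
    {x : Fin n → ℝ} (hx : x ∈ P.face {i}) :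
    c ⬝ᵥ (Fin.snoc x 1 : Fin (n + 1) → ℝ) + d < 0 := by
  refine neg_on_face (isBounded_prodInterval hP.bounded) (fun v hv hvS => (h v hv).1 hvS) ?_
  rw [mem_prodInterval_face]
  simpa using hx

lemma CutsOff.pos_bottom (hP : P.IsSimple)
    (h : P.prodInterval.CutsOff {P.side i, P.top} c d) {x : Fin n → ℝ} (hx : x ∈ P.carrier) :
    0 < c ⬝ᵥ (Fin.snoc x 0 : Fin (n + 1) → ℝ) + d := by
  refine pos_on_face (isBounded_prodInterval hP.bounded) (S := {P.bottom})
    (fun v hv hvS => (h v hv).2 fun hv' => ?_) ?_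
  · have h0 := hvS.2 P.bottom rfl
    have h1 := hv'.2 P.top (by simp)
    rw [prodInterval_ell_zero] at h0
    rw [prodInterval_ell_one] at h1
    linarith
  · rw [mem_prodInterval_face]
    simpa [face] using hx

lemma CutsOff.pos_top (h : P.prodInterval.CutsOff {P.side i, P.top} c d) {v : Fin n → ℝ}
    (hv : v ∈ P.vertices) (hvi : 0 < P.ell i v) :
    0 < c ⬝ᵥ (Fin.snoc v 1 : Fin (n + 1) → ℝ) + d := by
  refine (h _ (mem_prodInterval_vertices.2 (by simpa using hv))).2 fun hv' => ?_
  have := hv'.2 (P.side i) (by simp)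
  rw [prodInterval_ell_inl, Fin.init_snoc] at this
  exact hvi.ne' this

/-- If facets `j` and `i` are disjoint, no vertex of `F j × I` belongs to the truncated face.
Contrapositively, a side facet meeting the new facet comes from a facet meeting `F i`. -/
lemma CutsOff.pos_of_disjoint (hP : P.IsSimple)
    (h : P.prodInterval.CutsOff {P.side i, P.top} c d) {j : P.ι}
    (hj : ¬ (P.face {j, i}).Nonempty) {y : Fin (n + 1) → ℝ} (hy : y ∈ P.prodInterval.carrier)
    (hyj : P.ell j (Fin.init y) = 0) : 0 < c ⬝ᵥ y + d := by
  refine pos_on_face (isBounded_prodInterval hP.bounded) (S := {P.side j})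
    (fun v hv hvS => (h v hv).2 fun hv' => hj ⟨Fin.init v, ?_⟩) ?_
  · have h0 := hvS.2 (P.side j) rfl
    have h1 := hv'.2 (P.side i) (by simp)
    rw [prodInterval_ell_inl] at h0 h1
    refine ⟨(mem_prodInterval_carrier.1 hv.1).1, ?_⟩
    rintro l (rfl | rfl) <;> assumption
  · refine ⟨hy, ?_⟩
    rintro _ rfl
    rw [prodInterval_ell_inl, hyj]

/-- The side facets in `S` come from a set `J` with `P.face J` nonempty, by flagness of `P`.
Pairwise intersection excludes bottom with top, bottom with the new facet, and top with side `i`. In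
the remaining cases a common point is found over `P.face J`, at a height allowed by `S`: with `h >
0` if the new facet is not in `S`, and otherwise with `h = 0` on a segment along which `h` changes
sign. -/
lemma CutsOff.isFlag (hP : P.IsSimple) (hF : P.IsFlag)
    (h : P.prodInterval.CutsOff {P.side i, P.top} c d) :
    (P.prodInterval.cut c d).IsFlag := by
  intro S hS
  set J : Set P.ι := {j | oldFacet (P.side j) ∈ S}
  have hpair : ∀ o ∈ S, ∀ o' ∈ S, ∃ y, y ∈ P.prodInterval.carrier ∧ 0 ≤ c ⬝ᵥ y + d ∧
      (P.prodInterval.cut c d).ell o y = 0 ∧ (P.prodInterval.cut c d).ell o' y = 0 := by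
    intro o ho o' ho'
    obtain ⟨y, hy, hy'⟩ := hS o ho o' ho'
    exact ⟨y, (mem_cut_carrier.1 hy).1, (mem_cut_carrier.1 hy).2, hy' o (by simp),
      hy' o' (by simp)⟩
  have hJface : (P.face J).Nonempty := hF J fun j hj k hk => by
    obtain ⟨y, hy, -, h1, h2⟩ := hpair _ hj _ hk
    rw [cut_ell_some, prodInterval_ell_inl] at h1 h2
    refine ⟨Fin.init y, (mem_prodInterval_carrier.1 hy).1, ?_⟩
    rintro l (rfl | rfl) <;> assumption
  have hmem : ∀ {x t}, x ∈ P.face J → 0 ≤ t → t ≤ 1 → (oldFacet P.bottom ∈ S → t = 0) →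
      (oldFacet P.top ∈ S → t = 1) →
      (Fin.snoc x t : Fin (n + 1) → ℝ) ∈ P.prodInterval.face {o | oldFacet o ∈ S} := by
    intro x t hx h0 h1 h2 h3
    rw [mem_prodInterval_face]
    simp only [Fin.init_snoc, Fin.snoc_last]
    exact ⟨hx, ⟨h0, h2⟩, h1, h3⟩
  have hi_top : oldFacet P.top ∈ S → i ∉ J := fun hS1 hi => by
    obtain ⟨y, hy, h0, h1, h2⟩ := hpair _ hi _ hS1
    rw [cut_ell_some, prodInterval_ell_inl] at h1
    rw [cut_ell_some, prodInterval_ell_one, sub_eq_zero] at h2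
    have hneg := h.neg hP (x := Fin.init y) ⟨(mem_prodInterval_carrier.1 hy).1, by
      rintro _ rfl
      exact h1⟩
    rw [h2, Fin.snoc_init_self] at hneg
    linarith
  -- Every `F j` with `j ∈ J` meets `F i`, so flagness of `P` applies to `J` together with `i`. Over
  -- the resulting point, `h < 0` at height `1`.
  have hcut : newFacet ∈ S → ∃ x ∈ P.face J, x ∈ P.face {i} := fun hSn => by
    have hmeet : ∀ j ∈ J, (P.face {j, i}).Nonempty := fun j hj => by
      obtain ⟨y, hy, -, h1, h2⟩ := hpair _ hj _ hSn
      rw [cut_ell_some, prodInterval_ell_inl] at h1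
      by_contra hcon
      exact (h.pos_of_disjoint hP hcon hy h1).ne' h2
    have hii : (P.face {i, i}).Nonempty := by
      obtain ⟨x, u, hx, -⟩ := hP.exists_facet_crossing i
      exact ⟨x, by simpa using hx⟩
    obtain ⟨x, hx, hx'⟩ := hF (insert i J) fun j hj k hk => by
      rcases hj with rfl | hj
      · rcases hk with rfl | hk
        · exact hii
        · rw [Set.pair_comm]
          exact hmeet k hk
      · rcases hk with rfl | hk
        · exact hmeet j hj
        · obtain ⟨x, hx, hx'⟩ := hJface
          refine ⟨x, hx, ?_⟩
          rintro l (rfl | rfl)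
          exacts [hx' _ hj, hx' _ hk]
    exact ⟨x, ⟨hx, fun j hj => hx' j (Set.mem_insert_of_mem _ hj)⟩, hx, by
      rintro _ rfl
      exact hx' _ (Set.mem_insert _ _)⟩
  have htop : oldFacet P.top ∈ S → ∃ x ∈ P.face J,
      0 < c ⬝ᵥ (Fin.snoc x 1 : Fin (n + 1) → ℝ) + d := fun hS1 => by
    obtain ⟨v, hv, hvJ, hvi⟩ := hP.exists_vertex_not_mem hJface (hi_top hS1)
    exact ⟨v, hvJ, h.pos_top hv hvi⟩
  have h01 : oldFacet P.bottom ∈ S → oldFacet P.top ∉ S := fun h0 h1 => by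
    obtain ⟨y, -, -, e0, e1⟩ := hpair _ h0 _ h1
    rw [cut_ell_some, prodInterval_ell_zero] at e0
    rw [cut_ell_some, prodInterval_ell_one] at e1
    linarith
  have h0n : oldFacet P.bottom ∈ S → newFacet ∉ S := fun h0 hn => by
    obtain ⟨y, hy, -, e0, e1⟩ := hpair _ h0 _ hn
    rw [cut_ell_some, prodInterval_ell_zero] at e0
    have hpos := h.pos_bottom hP (mem_prodInterval_carrier.1 hy).1
    have hy0 : (Fin.snoc (Fin.init y) 0 : Fin (n + 1) → ℝ) = y := by
      rw [← e0, Fin.snoc_init_self]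
    rw [hy0] at hpos
    exact hpos.ne' e1
  have h11 : (0 : ℝ) ≤ 1 := zero_le_one
  by_cases hn : newFacet ∈ S
  · have h0 : oldFacet P.bottom ∉ S := fun h0 => h0n h0 hn
    obtain ⟨x, hxJ, hxi⟩ := hcut hn
    obtain ⟨y, hy, hyc⟩ : ∃ y ∈ P.prodInterval.face {o | oldFacet o ∈ S}, 0 < c ⬝ᵥ y + d := by
      by_cases h1 : oldFacet P.top ∈ S
      · obtain ⟨z, hz, hzc⟩ := htop h1
        exact ⟨_, hmem hz h11 le_rfl (fun h => absurd h h0) fun _ => rfl, hzc⟩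
      · exact ⟨_, hmem hxJ le_rfl h11 (fun _ => rfl) fun h => absurd h h1,
          h.pos_bottom hP hxJ.1⟩
    obtain ⟨z, hz, hzc⟩ := exists_mem_face_eq_zero
      (hmem hxJ h11 le_rfl (fun h => absurd h h0) fun _ => rfl) hy (h.neg hP hxi) hyc
    exact ⟨z, mem_cut_face.2 ⟨hz, hzc.ge, fun _ => hzc⟩⟩
  · obtain ⟨y, hy, hyc⟩ : ∃ y ∈ P.prodInterval.face {o | oldFacet o ∈ S}, 0 < c ⬝ᵥ y + d := by
      by_cases h1 : oldFacet P.top ∈ S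
      · obtain ⟨z, hz, hzc⟩ := htop h1
        exact ⟨_, hmem hz h11 le_rfl (fun h => absurd h1 (h01 h)) fun _ => rfl, hzc⟩
      · obtain ⟨x, hx⟩ := hJface
        exact ⟨_, hmem hx le_rfl h11 (fun _ => rfl) fun h => absurd h h1,
          h.pos_bottom hP hx.1⟩
    exact ⟨y, mem_cut_face.2 ⟨hy, hyc.le, fun h => absurd h hn⟩⟩

/-- Simplicity at vertices holds because the hyperplane misses all vertices of `P × I`. For
irredundancy each constraint needs a point violating it alone: over `F i` at height `1` for the new
one, just outside a facet at height `0` for a side, slightly below `P × 0` for the bottom, and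
slightly above a vertex off `F i` for the top. -/
lemma CutsOff.isSimple (hP : P.IsSimple)
    (h : P.prodInterval.CutsOff {P.side i, P.top} c d) :
    (P.prodInterval.cut c d).IsSimple where
  bounded := (isBounded_prodInterval hP.bounded).subset fun y hy => (mem_cut_carrier.1 hy).1
  full_dim := by
    obtain ⟨x, hx⟩ := hP.exists_forall_pos
    have hbot := h.pos_bottom hP (x := x) fun j => (hx j).le
    have hcont : Continuous fun t : ℝ => c ⬝ᵥ (Fin.snoc x t : Fin (n + 1) → ℝ) + d := by
      simp only [dotProduct_snoc_right]
      fun_prop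
    have h1 : ∀ᶠ t in nhdsWithin (0 : ℝ) (Set.Ioi 0),
        0 < c ⬝ᵥ (Fin.snoc x t : Fin (n + 1) → ℝ) + d :=
      ((hcont.tendsto 0).eventually_const_lt hbot).filter_mono nhdsWithin_le_nhds
    obtain ⟨t, ht, ht'⟩ := (h1.and (Ioo_mem_nhdsGT (zero_lt_one (α := ℝ)))).exists
    refine interior_nonempty_of_forall_pos (x := Fin.snoc x t)
      (cut_forall.2 ⟨ht, prodInterval_forall.2 ⟨fun j => ?_, ?_, ?_⟩⟩)
    · simpa [cut_ell_some, prodInterval_ell_inl] using hx j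
    · simpa [cut_ell_some, prodInterval_ell_zero] using ht'.1
    · simpa [cut_ell_some, prodInterval_ell_one] using ht'.2
  irredundant := by
    obtain ⟨p, hp⟩ := hP.carrier_nonempty
    have hcont : ∀ x : Fin n → ℝ,
        Continuous fun t : ℝ => c ⬝ᵥ (Fin.snoc x t : Fin (n + 1) → ℝ) + d := fun x => by
      simp only [dotProduct_snoc_right]
      fun_prop
    refine cut_forall.2 ⟨?_, prodInterval_forall.2 ⟨fun j => ?_, ?_, ?_⟩⟩
    · obtain ⟨x, u, hx, -⟩ := hP.exists_facet_crossing i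
      refine ⟨Fin.snoc x 1, h.neg hP hx,
        cut_forall.2 ⟨fun h => absurd rfl h, prodInterval_forall.2 ⟨fun j _ => ?_, ?_, ?_⟩⟩⟩
      · simpa [cut_ell_some, prodInterval_ell_inl] using hx.1 j
      · simp [cut_ell_some, prodInterval_ell_zero]
      · simp [cut_ell_some, prodInterval_ell_one]
    · obtain ⟨x, u, hx, hu⟩ := hP.exists_facet_crossing j
      have hc : Continuous fun t : ℝ =>
          c ⬝ᵥ (Fin.snoc (x + t • u) 0 : Fin (n + 1) → ℝ) + d := by
        simp only [dotProduct_snoc_right]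
        fun_prop
      have h1 : ∀ᶠ t in nhdsWithin (0 : ℝ) (Set.Ioi 0),
          0 < c ⬝ᵥ (Fin.snoc (x + t • u) 0 : Fin (n + 1) → ℝ) + d := by
        refine ((hc.tendsto 0).eventually_const_lt ?_).filter_mono nhdsWithin_le_nhds
        simpa using h.pos_bottom hP hx.1
      obtain ⟨t, ⟨htj, htl⟩, ht⟩ := (hu.and h1).exists
      refine ⟨Fin.snoc (x + t • u) 0, by simpa [cut_ell_some, prodInterval_ell_inl] using htj,
        cut_forall.2 ⟨fun _ => ht.le, prodInterval_forall.2 ⟨fun l hl => ?_, ?_, ?_⟩⟩⟩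
      · rw [cut_ell_some, prodInterval_ell_inl, Fin.init_snoc]
        exact htl l fun hlj => hl (hlj ▸ rfl)
      · simp [cut_ell_some, prodInterval_ell_zero]
      · simp [cut_ell_some, prodInterval_ell_one]
    · have h1 : ∀ᶠ t in nhdsWithin (0 : ℝ) (Set.Iio 0),
          0 < c ⬝ᵥ (Fin.snoc p t : Fin (n + 1) → ℝ) + d :=
        (((hcont p).tendsto 0).eventually_const_lt (h.pos_bottom hP hp)).filter_mono
          nhdsWithin_le_nhds
      obtain ⟨t, ht, ht0 : t < 0⟩ := (h1.and self_mem_nhdsWithin).exists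
      refine ⟨Fin.snoc p t, by simpa [cut_ell_some, prodInterval_ell_zero] using ht0,
        cut_forall.2 ⟨fun _ => ht.le, prodInterval_forall.2
          ⟨fun l _ => ?_, fun h => absurd rfl h, fun _ => ?_⟩⟩⟩
      · simpa [cut_ell_some, prodInterval_ell_inl] using hp l
      · rw [cut_ell_some, prodInterval_ell_one, Fin.snoc_last]
        linarith
    · obtain ⟨v, hv, -, hvi⟩ := hP.exists_vertex_not_mem (S := ∅)
        (by rw [face_empty]; exact ⟨p, hp⟩) (Set.notMem_empty i)
      have h1 : ∀ᶠ t in nhdsWithin (1 : ℝ) (Set.Ioi 1),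
          0 < c ⬝ᵥ (Fin.snoc v t : Fin (n + 1) → ℝ) + d :=
        (((hcont v).tendsto 1).eventually_const_lt (h.pos_top hv hvi)).filter_mono
          nhdsWithin_le_nhds
      obtain ⟨t, ht, ht0 : 1 < t⟩ := (h1.and self_mem_nhdsWithin).exists
      refine ⟨Fin.snoc v t, by simpa [cut_ell_some, prodInterval_ell_one] using ht0,
        cut_forall.2 ⟨fun _ => ht.le, prodInterval_forall.2
          ⟨fun l _ => ?_, fun _ => ?_, fun h => absurd rfl h⟩⟩⟩
      · simpa [cut_ell_some, prodInterval_ell_inl] using hv.1 l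
      · rw [cut_ell_some, prodInterval_ell_zero, Fin.snoc_last]
        linarith
  simple w hw := ncard_cut (isBounded_prodInterval hP.bounded)
    (fun x hx => hP.ncard_prodInterval hx)
    (fun v hv => by
      by_cases hvS : v ∈ P.prodInterval.face {P.side i, P.top}
      · exact ((h v hv).1 hvS).ne
      · exact ((h v hv).2 hvS).ne') hw

/-- The inclusion of `Z P` over the bottom facet `P × 0` of a face cut of `P`. -/
def toZCut (hc : ∀ x ∈ P.carrier, 0 ≤ c ⬝ᵥ (Fin.snoc x 0 : Fin (n + 1) → ℝ) + d) :
    P.Z ⟶ (P.prodInterval.cut c d).Z :=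
  TopCat.ofHom
    -- The extra coordinates are real square roots of the values `h`, `0` and `1` of the new, bottom
    -- and top functions at `(x, 0)`.
    { toFun := fun p => ⟨(Fin.snoc p.1.1 0, fun o => o.elim
          ((√(c ⬝ᵥ (Fin.snoc p.1.1 0 : Fin (n + 1) → ℝ) + d) : ℝ) : ℂ)
          (Sum.elim p.1.2 ![0, 1])), by
        refine ⟨mem_cut_carrier.2 ⟨mem_prodInterval_carrier.2 ?_, hc _ p.2.1⟩,
          cut_forall.2 ⟨?_, prodInterval_forall.2 ⟨fun i => ?_, ?_, ?_⟩⟩⟩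
        · simpa using p.2.1
        · change ‖((√(c ⬝ᵥ (Fin.snoc p.1.1 0 : Fin (n + 1) → ℝ) + d) : ℝ) : ℂ)‖ ^ 2 = _
          rw [Complex.norm_real, Real.norm_of_nonneg (Real.sqrt_nonneg _),
            Real.sq_sqrt (hc _ p.2.1), cut_ell_none]
        · rw [cut_ell_some, prodInterval_ell_inl, Fin.init_snoc]
          exact p.2.2 i
        · change ‖(0 : ℂ)‖ ^ 2 = _
          simp [cut_ell_some, prodInterval_ell_zero]
        · change ‖(1 : ℂ)‖ ^ 2 = _
          simp [cut_ell_some, prodInterval_ell_one]⟩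
      continuous_toFun := by
        refine Continuous.subtype_mk (Continuous.prodMk ?_ (continuous_pi
          (cut_forall.2 ⟨?_, prodInterval_forall.2 ⟨fun i => ?_, ?_, ?_⟩⟩))) _
        · exact Continuous.finSnoc (A := fun _ => ℝ)
            (continuous_fst.comp continuous_subtype_val) continuous_const
        · refine Complex.continuous_ofReal.comp (Real.continuous_sqrt.comp ?_)
          simp only [dotProduct_snoc_right]
          fun_prop
        · exact (continuous_apply i).comp (continuous_snd.comp continuous_subtype_val)
        · exact continuous_const
        · exact continuous_const }

/-- The projection of the moment-angle manifold of a face cut of `P` onto `Z P`. -/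
def ofZCut (P : HPolytope n) (c : Fin (n + 1) → ℝ) (d : ℝ) : (P.prodInterval.cut c d).Z ⟶ P.Z :=
  TopCat.ofHom
    { toFun := fun p => ⟨(Fin.init p.1.1, fun i => p.1.2 (oldFacet (P.side i))), by
        refine ⟨(mem_prodInterval_carrier.1 (mem_cut_carrier.1 p.2.1).1).1, fun i => ?_⟩
        rw [p.2.2 (oldFacet (P.side i)), cut_ell_some, prodInterval_ell_inl]⟩
      continuous_toFun := by
        refine Continuous.subtype_mk (Continuous.prodMk ?_ (continuous_pi fun i => ?_)) _
        · exact (continuous_fst.comp continuous_subtype_val).finInit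
        · exact (continuous_apply _).comp (continuous_snd.comp continuous_subtype_val) }

lemma toZCut_ofZCut (hc : ∀ x ∈ P.carrier, 0 ≤ c ⬝ᵥ (Fin.snoc x 0 : Fin (n + 1) → ℝ) + d) :
    toZCut hc ≫ ofZCut P c d = 𝟙 P.Z := by
  ext p
  refine Subtype.ext (Prod.ext ?_ rfl)
  exact Fin.init_snoc (α := fun _ => ℝ) 0 p.1.1

end FaceCut

/-! ### Existence and iteration of face cuts. -/

lemma IsFaceCut.isSimple {Q : HPolytope (n + 1)} (hQ : IsFaceCut P Q) (hP : P.IsSimple) :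
    Q.IsSimple := by
  obtain ⟨i, c, d, h, rfl⟩ := hQ
  exact h.isSimple hP

lemma IsFaceCut.isFlag {Q : HPolytope (n + 1)} (hQ : IsFaceCut P Q) (hP : P.IsSimple)
    (hF : P.IsFlag) : Q.IsFlag := by
  obtain ⟨i, c, d, h, rfl⟩ := hQ
  exact h.isFlag hP hF

lemma IsFaceCut.hasNontrivialMasseyProduct {R : Type*} [CommRing R] {k : ℕ} {deg : Fin k → ℕ}
    {Q : HPolytope (n + 1)} (hQ : IsFaceCut P Q) (hP : P.IsSimple)
    (hM : HasNontrivialMasseyProduct R P.Z deg) : HasNontrivialMasseyProduct R Q.Z deg := by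
  obtain ⟨i, c, d, h, rfl⟩ := hQ
  exact hM.of_retract (toZCut_ofZCut fun x hx => (h.pos_bottom hP hx).le)

lemma IsSimple.nonempty_index (hP : P.IsSimple) (hn : 0 < n) : Nonempty P.ι := by
  by_contra! hempty
  have huniv : P.carrier = Set.univ := Set.eq_univ_of_forall fun x i => isEmptyElim i
  have : Nonempty (Fin n) := ⟨⟨0, hn⟩⟩
  exact NormedSpace.unbounded_univ ℝ (Fin n → ℝ) (huniv ▸ hP.bounded)

/-- Every facet of a simple polytope gives rise to a face cut. -/
lemma IsSimple.exists_isFaceCut (hP : P.IsSimple) (hn : 0 < n) : ∃ Q, IsFaceCut P Q := by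
  obtain ⟨i⟩ := hP.nonempty_index hn
  obtain ⟨ε, hε0, hε1, hε⟩ : ∃ ε : ℝ, 0 < ε ∧ ε < 1 ∧
      ∀ v ∈ P.vertices, 0 < P.ell i v → ε < P.ell i v := by
    have h1 : ∀ᶠ ε in nhdsWithin (0 : ℝ) (Set.Ioi 0),
        ∀ v ∈ P.vertices, 0 < P.ell i v → ε < P.ell i v :=
      (Set.Finite.eventually_all P.finite_vertices).2 fun v _ => by
        by_cases hv : 0 < P.ell i v
        · filter_upwards [Ioo_mem_nhdsGT hv] with ε hε _ using hε.2
        · exact .of_forall fun _ h => absurd h hv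
    obtain ⟨ε, h, h'⟩ := (h1.and (Ioo_mem_nhdsGT (zero_lt_one (α := ℝ)))).exists
    exact ⟨ε, h'.1, h'.2, h⟩
  -- The cutting function is `ℓ i + (1 - t) - ε`: it equals `-ε` on `F i × {1}`, is at least `1 - ε`
  -- at height `0`, and is positive at the other top vertices by the choice of `ε`.
  have hval : ∀ y : Fin (n + 1) → ℝ, (Fin.snoc (P.a i) (-1) : Fin (n + 1) → ℝ) ⬝ᵥ y +
      (P.b i + 1 - ε) = P.ell i (Fin.init y) + (1 - y (Fin.last n)) - ε := fun y => by
    rw [dotProduct_snoc]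
    simp only [ell]
    ring
  suffices h : P.prodInterval.CutsOff {P.side i, P.top} (Fin.snoc (P.a i) (-1)) (P.b i + 1 - ε) from
    ⟨_, i, _, _, h, rfl⟩
  refine fun y hy => ⟨fun hyS => ?_, fun hyS => ?_⟩
  · have h1 := hyS.2 (P.side i) (by simp)
    have h2 := hyS.2 P.top (by simp)
    rw [prodInterval_ell_inl] at h1
    rw [prodInterval_ell_one] at h2
    rw [hval, h1, h2]
    linarith
  · obtain ⟨hv, ht⟩ := mem_prodInterval_vertices.1 hy
    have hnn := hv.1 i
    rw [hval]
    rcases ht with ht | ht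
    · rw [ht]
      linarith
    · have hpos : 0 < P.ell i (Fin.init y) := by
        refine lt_of_le_of_ne hnn fun h0 => hyS ⟨hy.1, ?_⟩
        rintro _ (rfl | rfl)
        · rw [prodInterval_ell_inl, h0]
        · rw [prodInterval_ell_one, ht, sub_self]
      have := hε _ hv hpos
      rw [ht]
      linarith

open Classical in
/-- A face cut of `P`, if there is one. -/
def chooseFaceCut (P : HPolytope n) : HPolytope (n + 1) :=
  if h : ∃ Q, IsFaceCut P Q then h.choose else P.prodInterval

lemma isFaceCut_chooseFaceCut (h : ∃ Q, IsFaceCut P Q) : IsFaceCut P P.chooseFaceCut := by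
  rw [chooseFaceCut, dif_pos h]
  exact h.choose_spec

/-- The sequence of iterated face cuts starting with a polytope `F`. -/
def iteratedFaceCut {r : ℕ} (F : HPolytope r) (n : ℕ) : HPolytope n :=
  match n with
  -- Terms below `r` are placeholders; the recursion is reset to `F` at index `r`.
  | 0 => if h : r = 0 then (h ▸ F) else ⟨Empty, inferInstance, Empty.elim, Empty.elim⟩
  | n + 1 => if h : r = n + 1 then (h ▸ F) else (iteratedFaceCut F n).chooseFaceCut

lemma iteratedFaceCut_self {r : ℕ} (F : HPolytope r) : iteratedFaceCut F r = F := by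
  cases r <;> simp [iteratedFaceCut]

lemma iteratedFaceCut_succ {r : ℕ} (F : HPolytope r) {n : ℕ} (h : r ≤ n) :
    iteratedFaceCut F (n + 1) = (iteratedFaceCut F n).chooseFaceCut := by
  rw [iteratedFaceCut, dif_neg (by omega)]

lemma IsSimple.isFaceCutSequence {r : ℕ} {F : HPolytope r} (hF : F.IsSimple) (hr : 0 < r) :
    IsFaceCutSequence F (iteratedFaceCut F) := by
  have hstep : ∀ n, r ≤ n → (iteratedFaceCut F n).IsSimple →
      IsFaceCut (iteratedFaceCut F n) (iteratedFaceCut F (n + 1)) := fun n hn hs => by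
    rw [iteratedFaceCut_succ F hn]
    exact isFaceCut_chooseFaceCut (hs.exists_isFaceCut (hr.trans_le hn))
  have hs : ∀ n, r ≤ n → (iteratedFaceCut F n).IsSimple := fun n hn => by
    induction n, hn using Nat.le_induction with
    | base => rwa [iteratedFaceCut_self]
    | succ n hn ih => exact (hstep n hn ih).isSimple ih
  exact ⟨iteratedFaceCut_self F, fun n hn => hstep n hn (hs n hn)⟩

end HPolytope

end

theorem corollary4p2 (R : Type*) [CommRing R] {r : ℕ} (hr : 0 < r) (F : HPolytope r)
    (hF : F.IsSimple) (hFlag : F.IsFlag) {k : ℕ} (hk : 2 ≤ k) (deg : Fin k → ℕ)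
    (hM : HasNontrivialMasseyProduct R F.Z deg) :
    (∃ P : ∀ n, HPolytope n, HPolytope.IsFaceCutSequence F P) ∧
    ∀ P : ∀ n, HPolytope n, HPolytope.IsFaceCutSequence F P →
      ∀ n, r ≤ n → (P n).IsSimple ∧ (P n).IsFlag ∧ HasNontrivialMasseyProduct R (P n).Z deg := by
  refine ⟨⟨_, hF.isFaceCutSequence hr⟩, fun P ⟨hPr, hP⟩ n hn => ?_⟩
  induction n, hn using Nat.le_induction with
  | base => exact hPr ▸ ⟨hF, hFlag, hM⟩
  | succ n hn ih =>
    obtain ⟨h1, h2, h3⟩ := ih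
    have h := hP n hn
    exact ⟨h.isSimple h1, h.isFlag h1 h2, h.hasNontrivialMasseyProduct h1 h3⟩
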